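/- Let $\mathbb{N}=\{1,2,3,\dots\}$. For $A,B\subseteq\mathbb{N}$ and $n\in\mathbb{N}$ put $A-n=\{m\in\mathbb{N} : m+n\in A\}$ and $A-B=\bigcup_{b\in B}(A-b)$. A set $A\subseteq\mathbb{N}$ is syndetic if $A\cup(A-1)\cup\cdots\cup(A-N)=\mathbb{N}$ for some $N\in\mathbb{N}$; thick if for every finite $F\subseteq\mathbb{N}$ there is $n\in\mathbb{N}$ with $F+n\subseteq A$; and piecewise syndetic if $A\cup(A-1)\cup\cdots\cup(A-N)$ is thick for some $N\in\mathbb{N}$. A system $(X,T)$ is a nonempty compact metric space $X$ with a continuous map $T\colon X\to X$; it is minimal if the only nonempty closed $Y\subseteq X$ with $TY\subseteq Y$ is $X$. The set $A$ is a set of pointwise recurrence if for all minimal systems $(X,T)$, all $x\in X$ and all open $U\subseteq X$ with $x\in U$ there is $n\in A$ with $T^nx\in U$. Let $\beta\mathbb{N}$ be the set of ultrafilters on $\mathbb{N}$, with the addition given by $B\in p+q$ if and only if $\{n\in\mathbb{N} : B-n\in q\}\in p$, and let $\overline{A}=\{p\in\beta\mathbb{N} : A\in p\}$. A left ideal of $\beta\mathbb{N}$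 is a nonempty $L\subseteq\beta\mathbb{N}$ with $p+L\subseteq L$ for all $p\in\beta\mathbb{N}$; it is minimal if it is minimal under inclusion among the left ideals. **Theorem.** Let $A\subseteq\mathbb{N}$. The following are equivalent. 1. $A$ is a set of pointwise recurrence. 2. For all syndetic $S\subseteq\mathbb{N}$ there exists a finite set $F\subseteq A$ such that for all syndetic $S'\subseteq S$, $F\cap(S-S')\neq\emptyset$. 3. For all $B\subseteq\mathbb{N}$ with $B\supseteq A$ there exists a finite set $F\subseteq\mathbb{N}\setminus B$ such that $B\cup(B-F)$ is thick. 4. For all syndetic $S\subseteq\mathbb{N}$ and all thick $H\subseteq\mathbb{N}$ there exists a finite set $F\subseteq A$ such that for all syndetic $S'\subseteq S$, $(S'\cap H)\cap\big((S\cap H)-F\big)\neq\emptyset$. 5. For all piecewise syndetic $S\subseteq\mathbb{N}$ and all minimal left ideals $L\subseteq\beta\mathbb{N}$ with $\overline{S}\cap L\neq\emptyset$ there exists a finite set $F\subseteq A$ such that $\overline{S}\cap L\subseteq\overline{S-F}$. -/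

import Mathlib

/-! The positive integers are modelled by `ℕ+`. -/

universe u

namespace PointwiseRecurrence

/-- The translate `A - n = {m ∈ ℕ | m + n ∈ A}`. -/
def backShift (A : Set ℕ+) (n : ℕ+) : Set ℕ+ := {m | m + n ∈ A}

/-- The difference set `A - B = ⋃_{b ∈ B} (A - b)`, a set of positive integers. -/
def diffSet (A B : Set ℕ+) : Set ℕ+ := ⋃ b ∈ B, backShift A b

/-- `A` is syndetic: `A ∪ (A - 1) ∪ ⋯ ∪ (A - N) = ℕ` for some `N`. -/
def IsSyndetic (A : Set ℕ+) : Prop :=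
  ∃ N : ℕ+, A ∪ diffSet A (Set.Iic N) = Set.univ

/-- `A` is thick: it contains a translate `F + n` of every finite set `F`. -/
def IsThick (A : Set ℕ+) : Prop :=
  ∀ F : Finset ℕ+, ∃ n : ℕ+, ∀ f ∈ F, f + n ∈ A

/-- `A` is piecewise syndetic: `A ∪ (A - 1) ∪ ⋯ ∪ (A - N)` is thick for some `N`. -/
def IsPiecewiseSyndetic (A : Set ℕ+) : Prop :=
  ∃ N : ℕ+, IsThick (A ∪ diffSet A (Set.Iic N))

/-- The system `(X, T)` is minimal: its only subsystem (nonempty, closed, `T`-invariant subset)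
is `X` itself. -/
def IsMinimalSystem {X : Type u} [TopologicalSpace X] (T : X → X) : Prop :=
  ∀ Y : Set X, Y.Nonempty → IsClosed Y → Set.MapsTo T Y Y → Y = Set.univ

/-- `A` is a set of pointwise recurrence: for every minimal system `(X, T)` on a nonempty compact
metric space, every point `x` and every open neighborhood `U` of `x`, there is `n ∈ A` with
`T ^ n x ∈ U`. -/
def IsSetOfPointwiseRecurrence (A : Set ℕ+) : Prop :=
  ∀ (X : Type u) [MetricSpace X] [CompactSpace X] [Nonempty X] (T : X → X),
    Continuous T → IsMinimalSystem T →
    ∀ (x : X) (U : Set X), IsOpen U → x ∈ U → ∃ n ∈ A, T^[(n : ℕ)] x ∈ U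

section

attribute [local instance] Ultrafilter.add

/-- A left ideal of `(βℕ, +)`: a nonempty `L ⊆ βℕ` with `p + L ⊆ L` for all `p ∈ βℕ`. Here `βℕ` is
the set of ultrafilters, and `B ∈ p + q` iff `{n | B - n ∈ q} ∈ p`. -/
def IsLeftIdeal (L : Set (Ultrafilter ℕ+)) : Prop :=
  L.Nonempty ∧ ∀ p : Ultrafilter ℕ+, ∀ q ∈ L, p + q ∈ L

/-- The addition on ultrafilters is the one described above. -/
theorem mem_add_iff (p q : Ultrafilter ℕ+) (B : Set ℕ+) :
    B ∈ p + q ↔ {n | backShift B n ∈ q} ∈ p := by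
  refine (Ultrafilter.eventually_add p q (fun m => m ∈ B)).trans ?_
  have hB : ∀ n : ℕ+, backShift B n = {m | n + m ∈ B} := fun n => by
    simp only [backShift, add_comm]
  simp only [hB]
  rfl

end

/-- A minimal left ideal of `(βℕ, +)`: minimal under inclusion among all left ideals. -/
def IsMinimalLeftIdeal (L : Set (Ultrafilter ℕ+)) : Prop :=
  Minimal IsLeftIdeal L

/-- The basic clopen set `{p ∈ βℕ | A ∈ p}` of `βℕ` determined by `A ⊆ ℕ`. -/
def clopenOf (A : Set ℕ+) : Set (Ultrafilter ℕ+) := {p | A ∈ p}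

end PointwiseRecurrence

/-! The implications proved are 1 → 5 → 4 → 2 → 1 and 2 → 3 → 1. For 1 → 5, a minimal left ideal `L`
with `q ↦ 1 + q` is a minimal, usually nonmetrizable, system. Coding by membership in `S` gives a
metrizable factor, where 1 puts some `S - n` with `n ∈ A` in each `p ∈ L` containing `S`;
compactness of `clopenOf S ∩ L` makes the set of such `n` finite. For 5 → 4, a thick `H` belongs to
every member of some minimal left ideal, and a syndetic `S'` to some member `p`. Then `S'`, `H`, `S
- f` and `H - f` lie in `p` for some `f ∈ F`, so they have a common element. The case `H = ℕ` gives
2. The implications 2 → 1 and 3 → 1 argue by contradiction with visit times in a minimal system,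
which are syndetic. The main work is 2 → 3. If 3 fails for `B`, every finite subset of `C = {0} ∪
Bᶜ` has syndetically many translates in `C`. Then `C` contains a uniformly recurrent `Y` with `0 ∈
Y`, built from longer and longer words. Take `S = Y` and let `S'` be the positions where a long
prefix of `Y` reappears: small elements of `S - S'` lie in `Y`, hence outside `A`, against 2. -/

namespace PointwiseRecurrence

/-! ### Words and chains of occurrences -/

/-- A finite 0-1 word: the indicator of `carrier` on `[0, length)`. -/
structure Word where
  carrier : Set ℕ
  length : ℕ

/-- The word `w` occurs in (the indicator of) `S` at position `m`. -/
def Occurs (w : Word) (S : Set ℕ) (m : ℕ) : Prop :=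
  ∀ i < w.length, (m + i ∈ S ↔ i ∈ w.carrier)

theorem Occurs.congr {w : Word} {S S' : Set ℕ} {m : ℕ} (h : Occurs w S m)
    (hS : ∀ i, m ≤ i → i < m + w.length → (i ∈ S ↔ i ∈ S')) : Occurs w S' m := fun i hi =>
  (hS (m + i) (by omega) (by omega)).symm.trans (h i hi)

/-- The interval `[a, b)` of `S` contains successive occurrences of `w`, with all gaps
shorter than `T`. -/
inductive Chain (w : Word) (T : ℕ) (S : Set ℕ) : ℕ → ℕ → Prop
  | short {a b : ℕ} : a ≤ b → b < a + T → Chain w T S a b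
  | step {a m b : ℕ} : a ≤ m → m < a + T → Occurs w S m → Chain w T S (m + w.length) b →
      Chain w T S a b

/-- A chain of occurrences which starts and ends with an occurrence of `w`. -/
inductive StrongChain (w : Word) (T : ℕ) (S : Set ℕ) : ℕ → ℕ → Prop
  | single {m : ℕ} : Occurs w S m → StrongChain w T S m (m + w.length)
  | cons {m m' b : ℕ} : Occurs w S m → m + w.length ≤ m' → m' < m + w.length + T →
      StrongChain w T S m' b → StrongChain w T S m b

section Chain

variable {w : Word} {T : ℕ} {S S' : Set ℕ} {a b c d : ℕ}

theorem Chain.le (h : Chain w T S a b) : a ≤ b := by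
  induction h with
  | short h _ => exact h
  | step _ _ _ _ ih => omega

theorem StrongChain.le (h : StrongChain w T S a b) : a + w.length ≤ b := by
  induction h with
  | single _ => exact le_rfl
  | cons _ _ _ _ ih => omega

theorem Chain.congr (h : Chain w T S a b)
    (hS : ∀ i, a ≤ i → i < b → (i ∈ S ↔ i ∈ S')) : Chain w T S' a b := by
  induction h with
  | short h₁ h₂ => exact .short h₁ h₂
  | step h₁ h₂ h₃ h₄ ih =>
    have := h₄.le
    exact .step h₁ h₂ (h₃.congr fun i _ _ => hS i (by omega) (by omega))
      (ih fun i _ _ => hS i (by omega) (by omega))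

theorem StrongChain.congr_shift {t : ℕ} (h : StrongChain w T S a b)
    (hS : ∀ i, a ≤ i → i < b → (i ∈ S ↔ t + i ∈ S')) :
    StrongChain w T S' (t + a) (t + b) := by
  induction h with
  | single h =>
    rw [← add_assoc]
    refine .single fun i hi => ?_
    rw [add_assoc, ← hS _ (by omega) (by omega)]
    exact h i hi
  | cons h₁ h₂ h₃ h₄ ih =>
    have := h₄.le
    refine .cons (fun i hi => ?_) (by omega) (by omega)
      (ih fun i _ _ => hS i (by omega) (by omega))
    rw [add_assoc, ← hS _ (by omega) (by omega)]
    exact h₁ i hi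

theorem StrongChain.gap_trans_chain (h : StrongChain w T S b c) (hab : a ≤ b) (hba : b < a + T)
    (h' : Chain w T S c d) : Chain w T S a d := by
  induction h generalizing a with
  | single h => exact .step hab hba h h'
  | cons h₁ h₂ h₃ _ ih => exact .step hab hba h₁ (ih h₂ h₃ h')

/-- At a direct junction of two chains the end gaps would add up and could exceed the bound. A
strong chain in between has an occurrence at both ends, so neither gap grows. -/
theorem Chain.trans_strongChain_chain (h : Chain w T S a b) (h₁ : StrongChain w T S b c)
    (h₂ : Chain w T S c d) : Chain w T S a d := by
  induction h with
  | short h₃ h₄ => exact h₁.gap_trans_chain h₃ h₄ h₂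
  | step h₃ h₄ h₅ _ ih => exact .step h₃ h₄ h₅ (ih h₁)

theorem Occurs.strongChain_of_chain {m : ℕ} (hm : Occurs w S m)
    (h : Chain w T S (m + w.length) c) (h' : StrongChain w T S c d) :
    StrongChain w T S m d := by
  generalize ha : m + w.length = a at h
  induction h generalizing m with
  | short h₁ h₂ => exact .cons hm (by omega) (by omega) h'
  | step h₁ h₂ h₃ _ ih => exact .cons hm (by omega) (by omega) (ih h₃ h' rfl)

theorem StrongChain.trans_chain_strongChain (h : StrongChain w T S a b)
    (h₁ : Chain w T S b c) (h₂ : StrongChain w T S c d) : StrongChain w T S a d := by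
  induction h with
  | single h => exact h.strongChain_of_chain h₁ h₂
  | cons h₃ h₄ h₅ _ ih => exact .cons h₃ h₄ h₅ (ih h₁)

theorem StrongChain.exists_occurs (h : StrongChain w T S a b) {n : ℕ}
    (hn : a < n + T + w.length) (hb : n + T + w.length ≤ b) :
    ∃ m, n ≤ m ∧ m < n + T + w.length ∧ Occurs w S m := by
  induction h with
  | @single m h => exact ⟨m, by omega, hn, h⟩
  | @cons m m' b h₁ h₂ h₃ _ ih =>
    by_cases hm : n ≤ m
    · exact ⟨m, hm, hn, h₁⟩
    · exact ih (by omega) hb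

end Chain

/-! ### Construction of a uniformly recurrent subset -/

/-- The data after finitely many steps of the construction of a uniformly recurrent set inside
`C`: the current word, and the earlier words with bounds for the gaps between their occurrences. -/
structure Stage (C : Set ℕ) where
  word : Word
  earlier : Set (Word × ℕ)
  length_pos : 0 < word.length
  zero_mem : 0 ∈ word.carrier
  subset : word.carrier ⊆ C ∩ Set.Iio word.length
  strongChain : ∀ v ∈ earlier, StrongChain v.1 v.2 word.carrier 0 word.length
  fill : ∀ a b, a ≤ b → ∃ E : Set ℕ, E ⊆ C ∩ Set.Ico a b ∧ ∀ v ∈ earlier, Chain v.1 v.2 E a b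

/-- Every finite subset of `C` has syndetically many translates inside `C`. -/
def SyndeticTranslates (C : Set ℕ) : Prop :=
  ∀ F : Set ℕ, F.Finite → F ⊆ C → ∃ G, ∀ a, ∃ t, a ≤ t ∧ t < a + G ∧ ∀ f ∈ F, t + f ∈ C

section Construction

variable {C : Set ℕ}

/-- Fill intervals with occurrences of the current word, and the gaps with earlier words. -/
theorem Stage.fill_insert (s : Stage C) {G : ℕ}
    (hG : ∀ a, ∃ t, a ≤ t ∧ t < a + G ∧ ∀ f ∈ s.word.carrier, t + f ∈ C) (a b : ℕ) (hab : a ≤ b) :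
    ∃ E : Set ℕ, E ⊆ C ∩ Set.Ico a b ∧
      ∀ v ∈ insert (s.word, G + s.word.length) s.earlier, Chain v.1 v.2 E a b := by
  induction hn : b - a using Nat.strong_induction_on generalizing a with
  | _ n ih =>
  have hpos := s.length_pos
  by_cases hlt : b < a + (G + s.word.length)
  · obtain ⟨E, hE, hc⟩ := s.fill a b hab
    refine ⟨E, hE, fun v hv => ?_⟩
    rcases hv with rfl | hv
    · exact .short hab hlt
    · exact hc v hv
  -- The interval is long enough for a copy of the word at `t` to fit. Earlier words fill `[a, t)`,
  -- and the rest is handled by recursion.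
  · obtain ⟨t, hat, htG, ht⟩ := hG a
    obtain ⟨E₁, hE₁, hc₁⟩ := s.fill a t hat
    obtain ⟨E₂, hE₂, hc₂⟩ := ih (b - (t + s.word.length)) (by omega) (t + s.word.length)
      (by omega) rfl
    have hsub := s.subset
    set N := s.word.length with hN
    have mem₁ : ∀ i, i ∈ E₁ → i ∈ C ∧ a ≤ i ∧ i < t := fun i hi => hE₁ hi
    have mem₂ : ∀ i, i ∈ E₂ → i ∈ C ∧ t + N ≤ i ∧ i < b := fun i hi => hE₂ hi
    have memw : ∀ i, i ∈ s.word.carrier → i < N := fun i hi => (hsub hi).2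
    let E : Set ℕ := {i | i ∈ E₁ ∨ i ∈ E₂ ∨ ∃ f ∈ s.word.carrier, i = t + f}
    have e₁ : ∀ i, a ≤ i → i < t → (i ∈ E₁ ↔ i ∈ E) := by
      intro i _ _
      refine ⟨Or.inl, ?_⟩
      rintro (h | h | ⟨f, _, rfl⟩)
      · exact h
      · have := mem₂ i h; omega
      · omega
    have e₂ : ∀ i, t + N ≤ i → i < b → (i ∈ E₂ ↔ i ∈ E) := by
      intro i _ _
      refine ⟨fun h => .inr (.inl h), ?_⟩
      rintro (h | h | ⟨f, hf, rfl⟩)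
      · have := mem₁ i h; omega
      · exact h
      · have := memw f hf; omega
    have ew : ∀ i, 0 ≤ i → i < N → (i ∈ s.word.carrier ↔ t + i ∈ E) := by
      intro i _ _
      refine ⟨fun h => .inr (.inr ⟨i, h, rfl⟩), ?_⟩
      rintro (h | h | ⟨f, hf, hif⟩)
      · have := mem₁ _ h; omega
      · have := mem₂ _ h; omega
      · rwa [Nat.add_left_cancel hif]
    refine ⟨E, ?_, fun v hv => ?_⟩
    · rintro i (h | h | ⟨f, hf, rfl⟩)
      · have := mem₁ i h; exact ⟨this.1, this.2.1, by omega⟩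
      · have := mem₂ i h; exact ⟨this.1, by omega, this.2.2⟩
      · have := memw f hf; exact ⟨ht f hf, by omega, by omega⟩
    · have h₂ := (hc₂ v hv).congr e₂
      rcases hv with rfl | hv
      · exact .step hat (by simp only; omega) (fun i hi => (ew i (by omega) hi).symm) h₂
      · have h₁ := (hc₁ v hv).congr e₁
        have hw := (s.strongChain v hv).congr_shift ew
        rw [add_zero] at hw
        exact h₁.trans_strongChain_chain hw h₂

theorem Stage.exists_next (hC : SyndeticTranslates C) (s : Stage C) :
    ∃ s' : Stage C, s.word.length < s'.word.length ∧ Occurs s.word s'.word.carrier 0 ∧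
      s.earlier ⊆ s'.earlier ∧ ∃ T, (s.word, T) ∈ s'.earlier := by
  have hsub := s.subset
  have hpos := s.length_pos
  obtain ⟨G, hG⟩ := hC s.word.carrier
    ((Set.finite_Iio s.word.length).subset fun i hi => (hsub hi).2) fun i hi => (hsub hi).1
  obtain ⟨t, hNt, -, ht⟩ := hG s.word.length
  obtain ⟨E₁, hE₁, hc₁⟩ := s.fill_insert hG s.word.length t hNt
  set N := s.word.length with hN
  have mem₁ : ∀ i, i ∈ E₁ → i ∈ C ∧ N ≤ i ∧ i < t := fun i hi => hE₁ hi
  have memw : ∀ i, i ∈ s.word.carrier → i < N := fun i hi => (hsub hi).2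
  -- The new word has a copy of the old one at each end, so it is a strong chain for the old word as
  -- well as for all earlier ones.
  let E : Set ℕ := {i | i ∈ s.word.carrier ∨ i ∈ E₁ ∨ ∃ f ∈ s.word.carrier, i = t + f}
  have e₀ : ∀ i, i < N → (i ∈ s.word.carrier ↔ 0 + i ∈ E) := by
    intro i _
    rw [zero_add]
    refine ⟨Or.inl, ?_⟩
    rintro (h | h | ⟨f, hf, rfl⟩)
    · exact h
    · have := mem₁ i h; omega
    · omega
  have e₁ : ∀ i, N ≤ i → i < t → (i ∈ E₁ ↔ i ∈ E) := by
    intro i _ _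
    refine ⟨fun h => .inr (.inl h), ?_⟩
    rintro (h | h | ⟨f, hf, rfl⟩)
    · have := memw i h; omega
    · exact h
    · omega
  have ew : ∀ i, i < N → (i ∈ s.word.carrier ↔ t + i ∈ E) := by
    intro i _
    refine ⟨fun h => .inr (.inr ⟨i, h, rfl⟩), ?_⟩
    rintro (h | h | ⟨f, hf, hif⟩)
    · have := memw _ h; omega
    · have := mem₁ _ h; omega
    · rwa [Nat.add_left_cancel hif]
  have hocc : Occurs s.word E 0 := fun i hi => (e₀ i hi).symm
  have hocc' : Occurs s.word E t := fun i hi => (ew i hi).symm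
  refine ⟨⟨⟨E, t + N⟩, insert (s.word, G + N) s.earlier, by simp only; omega, .inl s.zero_mem,
    ?_, ?_, s.fill_insert hG⟩, by simp only; omega, hocc, Set.subset_insert _ _, G + N,
    Set.mem_insert _ _⟩
  · rintro i (h | h | ⟨f, hf, rfl⟩)
    · exact ⟨(hsub h).1, by have := memw i h; simp only [Set.mem_Iio]; omega⟩
    · have := mem₁ i h; exact ⟨this.1, by simp only [Set.mem_Iio]; omega⟩
    · have := memw f hf; exact ⟨ht f hf, by simp only [Set.mem_Iio]; omega⟩
  · intro v hv
    have h₁ := (hc₁ v hv).congr e₁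
    rcases hv with rfl | hv
    · have h₀ := StrongChain.single (T := G + N) hocc
      rw [zero_add] at h₀
      exact h₀.trans_chain_strongChain h₁ (.single hocc')
    · have h₀ := (s.strongChain v hv).congr_shift fun i _ hi => e₀ i hi
      have hw := (s.strongChain v hv).congr_shift fun i _ hi => ew i hi
      rw [zero_add, zero_add] at h₀
      exact h₀.trans_chain_strongChain h₁ hw

/-- If every finite subset of `C` has syndetically many translates inside `C`, then `C` contains
a uniformly recurrent set containing `0`. -/
theorem SyndeticTranslates.exists_uniformlyRecurrent (hC : SyndeticTranslates C) (h0 : 0 ∈ C) :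
    ∃ Y ⊆ C, 0 ∈ Y ∧ ∀ k, ∃ G, ∀ n, ∃ m, n ≤ m ∧ m < n + G ∧
      ∀ i < k, (m + i ∈ Y ↔ i ∈ Y) := by
  choose next hlen hocc hsub hmem using Stage.exists_next hC
  let s₀ : Stage C := ⟨⟨{0}, 1⟩, ∅, one_pos, rfl, by simpa using h0, by simp,
    fun a b _ => ⟨∅, by simp, by simp⟩⟩
  let s : ℕ → Stage C := fun k => next^[k] s₀
  have hs : ∀ k, s (k + 1) = next (s k) := fun k => Function.iterate_succ_apply' _ _ _
  have hmono : StrictMono fun k => (s k).word.length :=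
    strictMono_nat_of_lt_succ fun k => by simp only [hs]; exact hlen _
  have hk : ∀ k, k < (s k).word.length := fun k =>
    Nat.rec (s 0).length_pos (fun k ih => by have := hmono k.lt_succ_self; simp only at this; omega) k
  have hearl : Monotone fun k => (s k).earlier :=
    monotone_nat_of_le_succ fun k => by simp only [hs]; exact hsub _
  have hext : ∀ k l, k ≤ l → ∀ i < (s k).word.length,
      (i ∈ (s l).word.carrier ↔ i ∈ (s k).word.carrier) := by
    intro k l hkl i hi
    induction l, hkl using Nat.le_induction with
    | base => rfl
    | succ l hkl ih =>
      have := hocc (s l) i (hi.trans_le (hmono.monotone hkl))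
      rw [zero_add, ← hs] at this
      rw [this, ih]
  -- Each word is a prefix of the next and the `i`-th is longer than `i`, so `Y` is their common
  -- extension.
  let Y : Set ℕ := {i | i ∈ (s i).word.carrier}
  have hY : ∀ k, ∀ i < (s k).word.length, (i ∈ Y ↔ i ∈ (s k).word.carrier) := by
    intro k i hi
    rcases le_total i k with h | h
    · exact (hext i k h i (hk i)).symm
    · exact hext k i h i hi
  refine ⟨Y, fun i hi => ((s i).subset hi).1, (s 0).zero_mem, fun k => ?_⟩
  obtain ⟨T, hT⟩ := hmem (s k)
  rw [← hs] at hT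
  refine ⟨T + (s k).word.length, fun n => ?_⟩
  -- A stage later than `k` whose word is long enough to contain the search window together with `k`
  -- further letters.
  set l := n + T + (s k).word.length + (s k).word.length + k + 1 with hl
  have hc := (s l).strongChain _ (hearl (show k + 1 ≤ l by omega) hT)
  have hll := hk l
  obtain ⟨m, h₁, h₂, h₃⟩ := hc.exists_occurs
    (n := n) (by simp only; have := hk k; omega) (by simp only; omega)
  refine ⟨m, h₁, by simp only at h₂; omega, fun i hi => ?_⟩
  have hik := hi.trans (hk k)
  rw [hY l _ (by simp only at h₂; omega), hY k _ hik]
  exact h₃ i hik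

end Construction
theorem mem_diffSet {A B : Set ℕ+} {m : ℕ+} : m ∈ diffSet A B ↔ ∃ b ∈ B, m + b ∈ A := by
  simp only [diffSet, Set.mem_iUnion, exists_prop]
  rfl

theorem isSyndetic_iff {S : Set ℕ+} :
    IsSyndetic S ↔ ∃ N : ℕ+, ∀ m, m ∈ S ∨ ∃ n ≤ N, m + n ∈ S := by
  simp only [IsSyndetic, Set.eq_univ_iff_forall, Set.mem_union, mem_diffSet, Set.mem_Iic]

/-! ### Minimal left ideals of `βℕ` -/

section LeftIdeals

attribute [local instance] Ultrafilter.add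

theorem ultrafilter_add_assoc (p q r : Ultrafilter ℕ+) : p + q + r = p + (q + r) :=
  @add_assoc _ Ultrafilter.addSemigroup p q r

theorem mem_pure_add_iff (n : ℕ+) (p : Ultrafilter ℕ+) (B : Set ℕ+) :
    B ∈ (pure n : Ultrafilter ℕ+) + p ↔ backShift B n ∈ p := by
  rw [mem_add_iff, Ultrafilter.mem_pure]
  rfl

theorem isClosed_range_add (p : Ultrafilter ℕ+) : IsClosed (Set.range (· + p)) :=
  (isCompact_range (Ultrafilter.continuous_add_left p)).isClosed

theorem isLeftIdeal_range_add (p : Ultrafilter ℕ+) : IsLeftIdeal (Set.range (· + p)) := by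
  refine ⟨⟨p + p, p, rfl⟩, ?_⟩
  rintro q _ ⟨r, rfl⟩
  exact ⟨q + r, ultrafilter_add_assoc q r p⟩

variable {L : Set (Ultrafilter ℕ+)} {p : Ultrafilter ℕ+}

theorem IsLeftIdeal.range_add_subset (hL : IsLeftIdeal L) (hp : p ∈ L) :
    Set.range (· + p) ⊆ L := by
  rintro _ ⟨r, rfl⟩
  exact hL.2 r p hp

theorem IsMinimalLeftIdeal.range_add_eq (hL : IsMinimalLeftIdeal L) (hp : p ∈ L) :
    Set.range (· + p) = L :=
  hL.eq_of_subset (isLeftIdeal_range_add p) (hL.1.range_add_subset hp)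

theorem IsMinimalLeftIdeal.isClosed (hL : IsMinimalLeftIdeal L) : IsClosed L := by
  obtain ⟨p, hp⟩ := hL.1.1
  rw [← hL.range_add_eq hp]
  exact isClosed_range_add p

/-- Zorn's lemma applies to closed left ideals by compactness. A minimal closed one is minimal among
all left ideals, since every left ideal contains a closed one `βℕ + q`. -/
theorem IsLeftIdeal.exists_isMinimalLeftIdeal {M : Set (Ultrafilter ℕ+)} (hM : IsLeftIdeal M) :
    ∃ L ⊆ M, IsMinimalLeftIdeal L := by
  obtain ⟨p, hp⟩ := hM.1
  obtain ⟨L, hLp, hL⟩ := zorn_superset_nonempty {K | IsClosed K ∧ IsLeftIdeal K}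
    (fun c hc hchain hne => by
      refine ⟨⋂₀ c, ⟨isClosed_sInter fun K hK => (hc hK).1, ?_, ?_⟩,
        fun K hK => Set.sInter_subset_of_mem hK⟩
      · have := hne.to_subtype
        exact IsCompact.nonempty_sInter_of_directed_nonempty_isCompact_isClosed
          (fun K hK K' hK' => (hchain.total hK hK').elim (fun h => ⟨K, hK, subset_rfl, h⟩)
            fun h => ⟨K', hK', h, subset_rfl⟩) (fun K hK => (hc hK).2.1)
          (fun K hK => (hc hK).1.isCompact)
          (fun K hK => (hc hK).1)
      · exact fun q r hr K hK => (hc hK).2.2 q r (hr K hK))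
    _ ⟨isClosed_range_add p, isLeftIdeal_range_add p⟩
  refine ⟨L, hLp.trans (hM.range_add_subset hp), hL.1.2, fun K hK hKL => ?_⟩
  obtain ⟨q, hq⟩ := hK.1
  have hqK := hK.range_add_subset hq
  exact (hL.2 ⟨isClosed_range_add q, isLeftIdeal_range_add q⟩ (hqK.trans hKL)).trans hqK

theorem IsLeftIdeal.exists_mem_of_isSyndetic (hL : IsLeftIdeal L) {S : Set ℕ+}
    (hS : IsSyndetic S) : (clopenOf S ∩ L).Nonempty := by
  obtain ⟨q, hq⟩ := hL.1
  obtain ⟨N, hN⟩ := hS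
  have huniv : S ∪ diffSet S (Set.Iic N) ∈ q := hN ▸ Filter.univ_mem
  rcases Ultrafilter.union_mem_iff.1 huniv with h | h
  · exact ⟨q, h, hq⟩
  · obtain ⟨n, -, hn⟩ := (Ultrafilter.finite_biUnion_mem_iff (Set.finite_Iic N)).1 h
    exact ⟨pure n + q, (mem_pure_add_iff n q S).2 hn, hL.2 _ _ hq⟩

/-- Thickness is the finite intersection property for the sets `H - n`. An ultrafilter `p`
containing all of them satisfies `βℕ + p ⊆ clopenOf H`. -/
theorem IsThick.exists_subset_clopenOf {H : Set ℕ+} (hH : IsThick H) :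
    ∃ L, IsMinimalLeftIdeal L ∧ L ⊆ clopenOf H := by
  have hne : (Set.univ ∩ ⋂ n : ℕ+, {p : Ultrafilter ℕ+ | backShift H n ∈ p}).Nonempty := by
    refine isCompact_univ.inter_iInter_nonempty _ (fun n => ultrafilter_isClosed_basic _)
      fun F => ?_
    obtain ⟨n, hn⟩ := hH F
    refine ⟨pure n, trivial, Set.mem_iInter₂.2 fun f hf => Ultrafilter.mem_pure.2 ?_⟩
    change n + f ∈ H
    exact add_comm f n ▸ hn f hf
  obtain ⟨p, -, hp⟩ := hne
  rw [Set.mem_iInter] at hp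
  obtain ⟨L, hLp, hL⟩ := (isLeftIdeal_range_add p).exists_isMinimalLeftIdeal
  refine ⟨L, hL, hLp.trans ?_⟩
  rintro _ ⟨q, rfl⟩
  exact (mem_add_iff q p H).2 (Filter.mem_of_superset Filter.univ_mem fun n _ => hp n)

theorem IsLeftIdeal.backShift_mem {H : Set ℕ+} (hL : IsLeftIdeal L) (hLH : L ⊆ clopenOf H)
    (hp : p ∈ L) (n : ℕ+) : backShift H n ∈ p :=
  (mem_pure_add_iff n p H).1 (hLH (hL.2 (pure n) p hp))

/-- A closed subset of a minimal left ideal which is invariant under `q ↦ 1 + q` is trivial. -/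
theorem IsMinimalLeftIdeal.subset_of_isClosed (hL : IsMinimalLeftIdeal L)
    {Z : Set (Ultrafilter ℕ+)} (hZ : IsClosed Z) (hZL : Z ⊆ L) (hne : Z.Nonempty)
    (hinv : ∀ q ∈ Z, (pure 1 : Ultrafilter ℕ+) + q ∈ Z) : L ⊆ Z := by
  refine hL.2 ⟨hne, fun p q hq => ?_⟩ hZL
  have hpure : ∀ n : ℕ+, (pure n : Ultrafilter ℕ+) + q ∈ Z := by
    intro n
    induction n using PNat.recOn with
    | one => exact hinv q hq
    | succ n ih =>
      have hadd : (pure (n + 1) : Ultrafilter ℕ+) + q = pure 1 + (pure n + q) := by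
        refine Ultrafilter.ext fun B => ?_
        rw [mem_pure_add_iff, mem_pure_add_iff, mem_pure_add_iff]
        have : backShift B (n + 1) = backShift (backShift B 1) n := by
          ext m
          change m + (n + 1) ∈ B ↔ m + n + 1 ∈ B
          rw [add_assoc]
        rw [this]
      rw [hadd]
      exact hinv _ ih
  -- This closed set contains the principal ultrafilters, which are dense, so it is all of `βℕ`.
  have hclosed : IsClosed {r : Ultrafilter ℕ+ | r + q ∈ Z} :=
    hZ.preimage (Ultrafilter.continuous_add_left q)
  have hall : closure (Set.range (pure : ℕ+ → Ultrafilter ℕ+)) ⊆ {r | r + q ∈ Z} :=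
    closure_minimal (Set.range_subset_iff.2 hpure) hclosed
  rw [denseRange_pure.closure_range] at hall
  exact hall (Set.mem_univ p)

end LeftIdeals

/-! ### Visit times and symbolic factors -/

section Recurrence

/-- The times `n` at which `x` visits `U`. -/
def visitTimes {X : Type u} (T : X → X) (x : X) (U : Set X) : Set ℕ+ := {n | T^[(n : ℕ)] x ∈ U}

theorem IsMinimalSystem.exists_iterate_mem {X : Type u} [TopologicalSpace X] {T : X → X}
    (hT : Continuous T) (hmin : IsMinimalSystem T) {U : Set X} (hU : IsOpen U) (hne : U.Nonempty)
    (x : X) : ∃ n : ℕ+, T^[(n : ℕ)] x ∈ U := by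
  have hmaps : Set.MapsTo T (Set.range fun n : ℕ+ => T^[(n : ℕ)] x)
      (Set.range fun n : ℕ+ => T^[(n : ℕ)] x) := by
    rintro _ ⟨n, rfl⟩
    exact ⟨n + 1, by simp only [PNat.add_coe, PNat.one_coe, Function.iterate_succ_apply']⟩
  have huniv := hmin (closure (Set.range fun n : ℕ+ => T^[(n : ℕ)] x))
    (Set.range_nonempty _).closure isClosed_closure (hmaps.closure hT)
  obtain ⟨y, hy⟩ := hne
  obtain ⟨_, hz, n, rfl⟩ := mem_closure_iff.1 (huniv ▸ Set.mem_univ y) U hU hy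
  exact ⟨n, hz⟩

theorem IsMinimalSystem.isSyndetic_visitTimes {X : Type u} [TopologicalSpace X] [CompactSpace X]
    {T : X → X} (hT : Continuous T) (hmin : IsMinimalSystem T) {U : Set X} (hU : IsOpen U)
    (hne : U.Nonempty) (x : X) : IsSyndetic (visitTimes T x U) := by
  obtain ⟨F, hF⟩ := isCompact_univ.elim_finite_subcover (fun n : ℕ+ => T^[(n : ℕ)] ⁻¹' U)
    (fun n => hU.preimage (hT.iterate n)) fun y _ =>
      Set.mem_iUnion.2 (hmin.exists_iterate_mem hT hU hne y)
  obtain ⟨N, hN⟩ := F.exists_le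
  refine isSyndetic_iff.2 ⟨N, fun m => .inr ?_⟩
  obtain ⟨n, hn, hmem⟩ := Set.mem_iUnion₂.1 (hF (Set.mem_univ (T^[(m : ℕ)] x)))
  refine ⟨n, hN n hn, ?_⟩
  change T^[((m + n : ℕ+) : ℕ)] x ∈ U
  rwa [PNat.add_coe, add_comm, Function.iterate_add_apply]

/-- The return times of `x` to a neighborhood `U`, intersected with finitely many of their
translates by return times, are syndetic. -/
theorem IsMinimalSystem.isSyndetic_visitTimes_inter {X : Type u} [TopologicalSpace X]
    [CompactSpace X] {T : X → X} (hT : Continuous T) (hmin : IsMinimalSystem T) {U : Set X}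
    (hU : IsOpen U) {x : X} (hx : x ∈ U) (F : Finset ℕ+) (hF : (F : Set ℕ+) ⊆ visitTimes T x U) :
    ∃ R, IsSyndetic R ∧ ∀ t ∈ R, t ∈ visitTimes T x U ∧ ∀ f ∈ F, t + f ∈ visitTimes T x U := by
  have hV : IsOpen (U ∩ ⋂ f ∈ F, T^[(f : ℕ)] ⁻¹' U) :=
    hU.inter (isOpen_biInter_finset fun f _ => hU.preimage (hT.iterate f))
  refine ⟨_, hmin.isSyndetic_visitTimes hT hV ⟨x, hx, Set.mem_iInter₂.2 hF⟩ x, fun t ht =>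
    ⟨ht.1, fun f hf => ?_⟩⟩
  have := Set.mem_iInter₂.1 ht.2 f hf
  change T^[((t + f : ℕ+) : ℕ)] x ∈ U
  rwa [PNat.add_coe, add_comm, Function.iterate_add_apply]

/-- The set `S - n`, also for `n = 0`. -/
def iterBackShift (S : Set ℕ+) : ℕ → Set ℕ+
  | 0 => S
  | n + 1 => backShift (iterBackShift S n) 1

theorem iterBackShift_coe (S : Set ℕ+) (n : ℕ+) : iterBackShift S n = backShift S n := by
  induction n using PNat.recOn with
  | one => rfl
  | succ n ih =>
    rw [PNat.add_coe, PNat.one_coe, iterBackShift, ih]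
    ext m
    change m + 1 + n ∈ S ↔ m + (n + 1) ∈ S
    rw [add_assoc, add_comm n]

/-- The itinerary of an ultrafilter `q` under `q ↦ 1 + q` with respect to `S`. -/
noncomputable def itinerary (S : Set ℕ+) (q : Ultrafilter ℕ+) (n : ℕ) : Bool :=
  Set.boolIndicator {r : Ultrafilter ℕ+ | iterBackShift S n ∈ r} q

theorem itinerary_eq_true_iff {S : Set ℕ+} {q : Ultrafilter ℕ+} {n : ℕ} :
    itinerary S q n = true ↔ iterBackShift S n ∈ q :=
  (Set.mem_iff_boolIndicator _ q).symm

theorem continuous_itinerary (S : Set ℕ+) : Continuous (itinerary S) :=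
  continuous_pi fun _ => (continuous_boolIndicator_iff_isClopen _).2
    ⟨ultrafilter_isClosed_basic _, ultrafilter_isOpen_basic _⟩

attribute [local instance] Ultrafilter.add

theorem itinerary_pure_one_add (S : Set ℕ+) (q : Ultrafilter ℕ+) :
    itinerary S ((pure 1 : Ultrafilter ℕ+) + q) = fun n => itinerary S q (n + 1) := by
  funext n
  rw [Bool.eq_iff_iff, itinerary_eq_true_iff, itinerary_eq_true_iff, mem_pure_add_iff]
  rfl

/-- Recurrence in metrizable minimal systems gives recurrence in minimal left ideals, through a
symbolic factor. -/
theorem IsSetOfPointwiseRecurrence.exists_backShift_mem {A : Set ℕ+}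
    (hA : IsSetOfPointwiseRecurrence.{u} A) {L : Set (Ultrafilter ℕ+)} (hL : IsMinimalLeftIdeal L)
    {p : Ultrafilter ℕ+} (hp : p ∈ L) {S : Set ℕ+} (hS : S ∈ p) : ∃ n ∈ A, backShift S n ∈ p := by
  let K : Set (ℕ → Bool) := itinerary S '' L
  have hK : IsCompact K := hL.isClosed.isCompact.image (continuous_itinerary S)
  have hKc : CompactSpace K := isCompact_iff_compactSpace.1 hK
  let _ : MetricSpace K := TopologicalSpace.metrizableSpaceMetric K
  have hshift : ∀ x ∈ K, (fun n => x (n + 1)) ∈ K := by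
    rintro _ ⟨q, hq, rfl⟩
    exact ⟨pure 1 + q, hL.1.2 _ q hq, itinerary_pure_one_add S q⟩
  let T : ULift.{u} K → ULift.{u} K := fun x => ⟨⟨fun n => x.down.1 (n + 1), hshift _ x.down.2⟩⟩
  have hT : Continuous T := by
    refine continuous_uliftUp.comp (Continuous.subtype_mk (continuous_pi fun n => ?_) _)
    exact (continuous_apply (n + 1)).comp (continuous_subtype_val.comp continuous_uliftDown)
  let toX : ∀ q ∈ L, ULift.{u} K := fun q hq => ⟨⟨itinerary S q, q, hq, rfl⟩⟩
  have : Nonempty (ULift.{u} K) := ⟨toX p hp⟩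
  -- A subsystem `Y` pulls back to a closed invariant subset of `L`, hence to all of `L`;
  -- itineraries map `L` onto `K`, so `Y` is everything.
  have hmin : IsMinimalSystem T := by
    intro Y hne hY hinv
    have hval : IsClosed ((fun x : ULift.{u} K => x.down.1) '' Y) :=
      (hY.isCompact.image (continuous_subtype_val.comp continuous_uliftDown)).isClosed
    have hsub := hL.subset_of_isClosed
      (Z := L ∩ itinerary S ⁻¹' ((fun x : ULift.{u} K => x.down.1) '' Y))
      (hL.isClosed.inter (hval.preimage (continuous_itinerary S))) Set.inter_subset_left
      (by
        obtain ⟨⟨⟨_, q, hq, rfl⟩⟩, hy⟩ := hne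
        exact ⟨q, hq, _, hy, rfl⟩)
      (by
        rintro q ⟨hq, y, hy, hyq⟩
        refine ⟨hL.1.2 _ q hq, T y, hinv hy, ?_⟩
        rw [itinerary_pure_one_add, ← hyq])
    refine Set.eq_univ_of_forall fun ⟨⟨x, q, hq, hqx⟩⟩ => ?_
    obtain ⟨y, hy, hyq⟩ := (hsub hq).2
    have : y = ⟨⟨x, q, hq, hqx⟩⟩ := ULift.ext _ _ (Subtype.ext (hyq.trans hqx))
    exact this ▸ hy
  have hiter : ∀ n x m, (T^[n] x).down.1 m = x.down.1 (m + n) := by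
    intro n
    induction n with
    | zero => exact fun x m => rfl
    | succ n ih =>
      intro x m
      rw [Function.iterate_succ_apply, ih]
      exact congrArg x.down.1 (by omega)
  have hcoord : Continuous fun x : ULift.{u} K => x.down.1 0 :=
    (continuous_apply 0).comp (continuous_subtype_val.comp continuous_uliftDown)
  -- The cylinder of sequences starting with `true`: the `n`-th iterate of the itinerary of `p` lies
  -- in it exactly when `S - n ∈ p`.
  have hU : IsOpen ((fun x : ULift.{u} K => x.down.1 0) ⁻¹' {true}) :=
    (isOpen_discrete ({true} : Set Bool)).preimage hcoord
  obtain ⟨n, hn, hmem⟩ := hA (ULift.{u} K) T hT hmin (toX p hp) _ hU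
    (itinerary_eq_true_iff.2 hS)
  refine ⟨n, hn, ?_⟩
  rw [← iterBackShift_coe, ← itinerary_eq_true_iff]
  have := hiter n (toX p hp) 0
  rw [zero_add] at this
  exact this.symm.trans hmem

theorem IsSetOfPointwiseRecurrence.exists_finset_subset_clopenOf {A : Set ℕ+}
    (hA : IsSetOfPointwiseRecurrence.{u} A) {L : Set (Ultrafilter ℕ+)} (hL : IsMinimalLeftIdeal L)
    (S : Set ℕ+) : ∃ F : Finset ℕ+, (F : Set ℕ+) ⊆ A ∧
      clopenOf S ∩ L ⊆ clopenOf (diffSet S (F : Set ℕ+)) := by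
  have hcomp : IsCompact (clopenOf S ∩ L) :=
    ((ultrafilter_isClosed_basic S).inter hL.isClosed).isCompact
  obtain ⟨F, hFA, hF, hcov⟩ := hcomp.elim_finite_subcover_image (b := A)
    (c := fun n => clopenOf (backShift S n)) (fun n _ => ultrafilter_isOpen_basic _)
    fun p hp => by
      obtain ⟨n, hn, h⟩ := hA.exists_backShift_mem hL hp.2 hp.1
      exact Set.mem_iUnion₂.2 ⟨n, hn, h⟩
  refine ⟨hF.toFinset, by simpa using hFA, fun p hp => ?_⟩
  obtain ⟨n, hn, h⟩ := Set.mem_iUnion₂.1 (hcov hp)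
  exact Filter.mem_of_superset h
    (Set.subset_biUnion_of_mem (u := backShift S) (by simpa using hn))

theorem exists_mem_backShift_of_diffSet_mem {S : Set ℕ+} {F : Finset ℕ+} {p : Ultrafilter ℕ+}
    (h : diffSet S (F : Set ℕ+) ∈ p) : ∃ f ∈ F, backShift S f ∈ p :=
  (Ultrafilter.finite_biUnion_mem_iff F.finite_toSet).1 h

end Recurrence

/-! ### From failure of thickness to uniform recurrence -/

theorem isThick_univ : IsThick Set.univ := fun _ => ⟨1, fun _ _ => trivial⟩

theorem IsSyndetic.isPiecewiseSyndetic {S : Set ℕ+} (hS : IsSyndetic S) :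
    IsPiecewiseSyndetic S := by
  obtain ⟨N, hN⟩ := hS
  exact ⟨N, hN ▸ isThick_univ⟩

/-- If `S'` consists of the positions in a set `Y` of natural numbers at which its initial segment
of length `k` reappears, then differences up to `k` between elements of `Y` and of `S'` lie
in `Y`. -/
theorem exists_isSyndetic_of_uniformlyRecurrent {Y : Set ℕ} (h0 : 0 ∈ Y)
    (hY : ∀ k, ∃ G, ∀ n, ∃ m, n ≤ m ∧ m < n + G ∧ ∀ i < k, (m + i ∈ Y ↔ i ∈ Y)) (k : ℕ) :
    ∃ S', IsSyndetic S' ∧ S' ⊆ {n : ℕ+ | (n : ℕ) ∈ Y} ∧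
      ∀ f ∈ diffSet {n : ℕ+ | (n : ℕ) ∈ Y} S', (f : ℕ) < k → (f : ℕ) ∈ Y := by
  obtain ⟨G, hG⟩ := hY (k + 1)
  -- Prefix length `k + 1` constrains position `0` even for `k = 0`, which gives `S' ⊆ Y`. The
  -- search below starts at `m + 1` to make the shift positive.
  refine ⟨{m | ∀ i < k + 1, ((m : ℕ) + i ∈ Y ↔ i ∈ Y)}, isSyndetic_iff.2 ⟨G.succPNat, fun m => ?_⟩,
    fun m hm => (hm 0 (Nat.succ_pos k)).2 h0, fun f hf hfk => ?_⟩
  · obtain ⟨t, ht, htG, h⟩ := hG (m + 1)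
    obtain ⟨n, hn⟩ : ∃ n : ℕ+, (n : ℕ) = t - m := CanLift.prf (t - m : ℕ) (by omega)
    refine .inr ⟨n, ?_, ?_⟩
    · rw [← PNat.coe_le_coe, Nat.succPNat_coe]
      omega
    · change ∀ i < k + 1, (((m + n : ℕ+) : ℕ) + i ∈ Y ↔ i ∈ Y)
      rwa [PNat.add_coe, hn, Nat.add_sub_cancel' (by omega)]
  · obtain ⟨s, hs, hfs⟩ := mem_diffSet.1 hf
    refine (hs f (by omega)).1 ?_
    rw [add_comm, ← PNat.add_coe]
    exact hfs

/-- Failure of thickness yields a finite `E` every translate of which contains some `t` outside `B ∪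
(B - F)`, that is, with `t` and `t + F` outside `B`. Adjoining `0` to `Bᶜ` is harmless because `t`
itself is outside `B`. -/
theorem syndeticTranslates_of_not_isThick {B : Set ℕ+}
    (hB : ∀ F : Finset ℕ+, (F : Set ℕ+) ⊆ Bᶜ → ¬ IsThick (B ∪ diffSet B (F : Set ℕ+))) :
    SyndeticTranslates (insert 0 ((fun n : ℕ+ => (n : ℕ)) '' Bᶜ)) := by
  intro F hF hFC
  have hfin : {f : ℕ+ | (f : ℕ) ∈ F}.Finite := hF.preimage PNat.coe_injective.injOn
  have hthick := hB hfin.toFinset fun f hf => by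
    rw [Set.Finite.coe_toFinset] at hf
    rcases hFC hf with h | ⟨g, hg, hgf⟩
    · exact absurd h f.ne_zero
    · exact PNat.coe_injective hgf ▸ hg
  rw [IsThick] at hthick
  push Not at hthick
  obtain ⟨E, hE⟩ := hthick
  obtain ⟨N, hN⟩ := E.exists_le
  refine ⟨N + 2, fun a => ?_⟩
  obtain ⟨e, he, hmem⟩ := hE a.succPNat
  have hle : (e : ℕ) ≤ N := hN e he
  rw [Set.mem_union, not_or] at hmem
  refine ⟨(e + a.succPNat : ℕ+), ?_, ?_, fun f hf => ?_⟩
  · rw [PNat.add_coe, Nat.succPNat_coe]; omega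
  · rw [PNat.add_coe, Nat.succPNat_coe]; omega
  · right
    rcases hFC hf with rfl | ⟨g, hg, rfl⟩
    · exact ⟨_, hmem.1, rfl⟩
    · refine ⟨e + a.succPNat + g, fun h => hmem.2 (mem_diffSet.2 ⟨g, ?_, h⟩), rfl⟩
      rw [Set.Finite.coe_toFinset]
      exact hf

/-! ### The implications -/

section Implications

variable {A : Set ℕ+}

theorem isSetOfPointwiseRecurrence_of_syndetic
    (h : ∀ S : Set ℕ+, IsSyndetic S → ∃ F : Finset ℕ+, (F : Set ℕ+) ⊆ A ∧
      ∀ S' : Set ℕ+, IsSyndetic S' → S' ⊆ S → ((F : Set ℕ+) ∩ diffSet S S').Nonempty) :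
    IsSetOfPointwiseRecurrence.{u} A := by
  intro X _ _ _ T hT hmin x U hU hx
  by_contra! hcon
  -- Shrinking `U` to `W` makes avoidance of `closure W` at the times in `F` an open condition,
  -- satisfied by `x` since its orbit avoids `U` at the times in `A`.
  obtain ⟨W, hWo, hxW, hWU⟩ : ∃ W, IsOpen W ∧ x ∈ W ∧ closure W ⊆ U := by
    obtain ⟨W, hW, hWc, hWU⟩ := exists_mem_nhds_isClosed_subset (hU.mem_nhds hx)
    exact ⟨interior W, isOpen_interior, mem_interior_iff_mem_nhds.2 hW,
      (closure_minimal interior_subset hWc).trans hWU⟩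
  obtain ⟨F, hFA, hF⟩ := h _ (hmin.isSyndetic_visitTimes hT hWo ⟨x, hxW⟩ x)
  have hV : IsOpen (W ∩ ⋂ f ∈ F, T^[(f : ℕ)] ⁻¹' (closure W)ᶜ) :=
    hWo.inter (isOpen_biInter_finset fun f _ =>
      isClosed_closure.isOpen_compl.preimage (hT.iterate f))
  obtain ⟨f, hfF, hf⟩ := hF _ (hmin.isSyndetic_visitTimes hT hV ⟨x, hxW, Set.mem_iInter₂.2
    fun f hf hfW => hcon f (hFA hf) (hWU hfW)⟩ x) fun n hn => hn.1
  obtain ⟨s, hs, hfs⟩ := mem_diffSet.1 hf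
  refine Set.mem_iInter₂.1 hs.2 f hfF (subset_closure ?_)
  change T^[((f + s : ℕ+) : ℕ)] x ∈ W at hfs
  rwa [PNat.add_coe, Function.iterate_add_apply] at hfs

theorem isSetOfPointwiseRecurrence_of_thick
    (h : ∀ B : Set ℕ+, A ⊆ B → ∃ F : Finset ℕ+, (F : Set ℕ+) ⊆ Bᶜ ∧
      IsThick (B ∪ diffSet B (F : Set ℕ+))) : IsSetOfPointwiseRecurrence.{u} A := by
  intro X _ _ _ T hT hmin x U hU hx
  by_contra! hcon
  obtain ⟨F, hF, hthick⟩ := h (visitTimes T x U)ᶜ hcon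
  rw [compl_compl] at hF
  obtain ⟨R, hR, hRF⟩ := hmin.isSyndetic_visitTimes_inter hT hU hx F hF
  obtain ⟨N, hN⟩ := isSyndetic_iff.1 hR
  -- Every translate of this interval meets `R`, whereas `R` is disjoint from the thick set.
  obtain ⟨n, hn⟩ := hthick (Finset.Icc 1 (1 + N))
  have hnot : ∀ k ≤ 1 + N, k + n ∉ R := by
    intro k hk hkR
    rcases hn k (Finset.mem_Icc.2 ⟨one_le, hk⟩) with h | h
    · exact h (hRF _ hkR).1
    · obtain ⟨f, hf, h⟩ := mem_diffSet.1 h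
      exact h ((hRF _ hkR).2 f hf)
  rcases hN (1 + n) with h | ⟨k, hk, h⟩
  · exact hnot 1 (PNat.lt_add_right 1 N).le h
  · refine hnot (1 + k) (by gcongr) ?_
    rwa [add_right_comm]

theorem exists_finset_isThick_of_syndetic
    (h : ∀ S : Set ℕ+, IsSyndetic S → ∃ F : Finset ℕ+, (F : Set ℕ+) ⊆ A ∧
      ∀ S' : Set ℕ+, IsSyndetic S' → S' ⊆ S → ((F : Set ℕ+) ∩ diffSet S S').Nonempty)
    (B : Set ℕ+) (hAB : A ⊆ B) :
    ∃ F : Finset ℕ+, (F : Set ℕ+) ⊆ Bᶜ ∧ IsThick (B ∪ diffSet B (F : Set ℕ+)) := by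
  by_contra! hcon
  obtain ⟨Y, hYC, h0, hY⟩ := (syndeticTranslates_of_not_isThick hcon).exists_uniformlyRecurrent
    (Set.mem_insert _ _)
  have hS : IsSyndetic {n : ℕ+ | (n : ℕ) ∈ Y} := by
    obtain ⟨S', hS', hsub, -⟩ := exists_isSyndetic_of_uniformlyRecurrent h0 hY 0
    obtain ⟨N, hN⟩ := isSyndetic_iff.1 hS'
    exact isSyndetic_iff.2 ⟨N, fun m => (hN m).imp (fun h => hsub h)
      fun ⟨n, hn, h⟩ => ⟨n, hn, hsub h⟩⟩
  obtain ⟨F, hFA, hF⟩ := h _ hS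
  obtain ⟨N, hN⟩ := F.exists_le
  obtain ⟨S', hS', hsub, hdiff⟩ := exists_isSyndetic_of_uniformlyRecurrent h0 hY (N + 1)
  obtain ⟨f, hfF, hf⟩ := hF S' hS' hsub
  have hle : (f : ℕ) ≤ N := hN f hfF
  rcases hYC (hdiff f hf (by omega)) with h | ⟨g, hg, hgf⟩
  · exact f.ne_zero h
  · exact hg (hAB (hFA (PNat.coe_injective hgf ▸ hfF)))

theorem exists_finset_inter_of_clopenOf
    (h : ∀ (S : Set ℕ+) (L : Set (Ultrafilter ℕ+)), IsPiecewiseSyndetic S →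
      IsMinimalLeftIdeal L → (clopenOf S ∩ L).Nonempty → ∃ F : Finset ℕ+, (F : Set ℕ+) ⊆ A ∧
        clopenOf S ∩ L ⊆ clopenOf (diffSet S (F : Set ℕ+)))
    (S H : Set ℕ+) (hS : IsSyndetic S) (hH : IsThick H) :
    ∃ F : Finset ℕ+, (F : Set ℕ+) ⊆ A ∧ ∀ S' : Set ℕ+, IsSyndetic S' → S' ⊆ S →
      ((S' ∩ H) ∩ diffSet (S ∩ H) (F : Set ℕ+)).Nonempty := by
  obtain ⟨L, hL, hLH⟩ := hH.exists_subset_clopenOf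
  obtain ⟨F, hFA, hF⟩ := h S L hS.isPiecewiseSyndetic hL (hL.1.exists_mem_of_isSyndetic hS)
  refine ⟨F, hFA, fun S' hS' hsub => ?_⟩
  obtain ⟨p, hpS, hpL⟩ := hL.1.exists_mem_of_isSyndetic hS'
  obtain ⟨f, hfF, hf⟩ := exists_mem_backShift_of_diffSet_mem
    (hF ⟨Filter.mem_of_superset hpS hsub, hpL⟩)
  obtain ⟨m, ⟨hmS, hmH⟩, hmf, hmfH⟩ := p.nonempty_of_mem (Filter.inter_mem
    (Filter.inter_mem hpS (hLH hpL)) (Filter.inter_mem hf (hL.1.backShift_mem hLH hpL f)))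
  exact ⟨m, ⟨hmS, hmH⟩, mem_diffSet.2 ⟨f, hfF, hmf, hmfH⟩⟩

end Implications

end PointwiseRecurrence

theorem theoremA (A : Set ℕ+) :
    List.TFAE [
      PointwiseRecurrence.IsSetOfPointwiseRecurrence.{u} A,
      ∀ S : Set ℕ+, PointwiseRecurrence.IsSyndetic S →
        ∃ F : Finset ℕ+, (F : Set ℕ+) ⊆ A ∧
          ∀ S' : Set ℕ+, PointwiseRecurrence.IsSyndetic S' → S' ⊆ S →
            ((F : Set ℕ+) ∩ PointwiseRecurrence.diffSet S S').Nonempty,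
      ∀ B : Set ℕ+, A ⊆ B →
        ∃ F : Finset ℕ+, (F : Set ℕ+) ⊆ Bᶜ ∧
          PointwiseRecurrence.IsThick (B ∪ PointwiseRecurrence.diffSet B (F : Set ℕ+)),
      ∀ S H : Set ℕ+, PointwiseRecurrence.IsSyndetic S → PointwiseRecurrence.IsThick H →
        ∃ F : Finset ℕ+, (F : Set ℕ+) ⊆ A ∧
          ∀ S' : Set ℕ+, PointwiseRecurrence.IsSyndetic S' → S' ⊆ S →
            ((S' ∩ H) ∩ PointwiseRecurrence.diffSet (S ∩ H) (F : Set ℕ+)).Nonempty,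
      ∀ (S : Set ℕ+) (L : Set (Ultrafilter ℕ+)),
        PointwiseRecurrence.IsPiecewiseSyndetic S → PointwiseRecurrence.IsMinimalLeftIdeal L →
        (PointwiseRecurrence.clopenOf S ∩ L).Nonempty →
        ∃ F : Finset ℕ+, (F : Set ℕ+) ⊆ A ∧
          PointwiseRecurrence.clopenOf S ∩ L ⊆
            PointwiseRecurrence.clopenOf (PointwiseRecurrence.diffSet S (F : Set ℕ+))] := by
  tfae_have 1 → 5 := fun h S L _ hL _ => h.exists_finset_subset_clopenOf hL S
  tfae_have 5 → 4 := PointwiseRecurrence.exists_finset_inter_of_clopenOf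
  tfae_have 4 → 2 := by
    intro h S hS
    obtain ⟨F, hFA, hF⟩ := h S Set.univ hS PointwiseRecurrence.isThick_univ
    refine ⟨F, hFA, fun S' hS' hsub => ?_⟩
    obtain ⟨m, hm, hmF⟩ := hF S' hS' hsub
    obtain ⟨f, hf, hmf⟩ := PointwiseRecurrence.mem_diffSet.1 hmF
    exact ⟨f, hf, PointwiseRecurrence.mem_diffSet.2 ⟨m, hm.1, add_comm m f ▸ hmf.1⟩⟩
  tfae_have 2 → 1 := PointwiseRecurrence.isSetOfPointwiseRecurrence_of_syndetic
  tfae_have 2 → 3 := PointwiseRecurrence.exists_finset_isThick_of_syndetic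
  tfae_have 3 → 1 := PointwiseRecurrence.isSetOfPointwiseRecurrence_of_thick
  tfae_finish
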